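/- Let $K\subset\mathbb R^n$ ($n\ge 1$) be a centrally-symmetric convex body (convex, compact, with non-empty interior, $K=-K$), and let $\|\cdot\|_K$ be the norm with unit ball $K$. Let $\alpha>0$ and suppose that $K$ is $2$-convex with constant $\alpha$, that is, $$\delta_K(\varepsilon)=\inf\left\{1-\left\|\tfrac{x+y}{2}\right\|_K :\ \|x\|_K,\|y\|_K\le 1,\ \|x-y\|_K\ge\varepsilon\right\}\ \ge\ \alpha\varepsilon^2\qquad\text{for all }0<\varepsilon\le 2 .$$ Suppose also that $K$ has volume $1$ and is in isotropic position with isotropic constant $L_K\ge 0$, that is, $\int_K\langle x,\theta\rangle^2\,dx=L_K^2|\theta|^2$ for all $\theta\in\mathbb R^n$. Let $D_n$ be the closed Euclidean unit ball in $\mathbb R^n$. Then $$c\sqrt\alpha\,\sqrt n\,D_n\subset K\qquad\text{and}\qquad c\sqrt\alpha\,\sqrt n\,L_K\,D_n\subset K .$$ Moreover, the isotropic position is a finite volume-ratio position for $K$, with a bound that depends only on $\alpha$: $$\min_{B\subset K}\left(\frac{|K|}{|B|}\right)^{1/n}\le\frac{C}{\sqrt\alpha},$$ where the minimum is over all Euclidean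 balls $B$ of positive radius contained in $K$ and $|\cdot|$ denotes volume. Here $c,C>0$ are universal constants (independent of $n$, $K$ and $\alpha$). -/

import Mathlib

open MeasureTheory Metric

/-- A centrally-symmetric convex body in `ℝⁿ`: a convex, compact set with non-empty interior
such that `K = -K`. -/
structure IsSymmConvexBody {n : ℕ} (K : Set (EuclideanSpace ℝ (Fin n))) : Prop where
  convex : Convex ℝ K
  isCompact : IsCompact K
  nonempty_interior : (interior K).Nonempty
  symm : K = -K

/-- The modulus of convexity
`δ_K(ε) = inf {1 - ‖(x+y)/2‖_K : ‖x‖_K ≤ 1, ‖y‖_K ≤ 1, ‖x-y‖_K ≥ ε}`.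
Here `‖·‖_K = gauge K` is the norm with unit ball `K`. For a centrally-symmetric convex body in
dimension `n ≥ 1` and `0 < ε ≤ 2` the set is non-empty and bounded below by `0`. -/
noncomputable def modulusOfConvexity {n : ℕ} (K : Set (EuclideanSpace ℝ (Fin n))) (ε : ℝ) : ℝ :=
  sInf {d : ℝ | ∃ x y : EuclideanSpace ℝ (Fin n),
    gauge K x ≤ 1 ∧ gauge K y ≤ 1 ∧ ε ≤ gauge K (x - y) ∧
      d = 1 - gauge K ((1 / 2 : ℝ) • (x + y))}

/-- `K` is a `2`-convex body with constant `α`: a centrally-symmetric convex body whose modulus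
of convexity satisfies `δ_K(ε) ≥ α ε²` for all `0 < ε ≤ 2`. -/
structure IsTwoConvexBody {n : ℕ} (K : Set (EuclideanSpace ℝ (Fin n))) (α : ℝ) : Prop where
  symmConvexBody : IsSymmConvexBody K
  le_modulus : ∀ ε : ℝ, 0 < ε → ε ≤ 2 → α * ε ^ 2 ≤ modulusOfConvexity K ε

/-- `K` is in isotropic position with isotropic constant `L`: `K` has volume one, and
`∫_K ⟨x, θ⟩² dx = L² |θ|²` for every `θ`. In dimension `n ≥ 1` the number `L ≥ 0` is
determined by `K`; it is `L_K`. -/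
structure IsIsotropicWith {n : ℕ} (K : Set (EuclideanSpace ℝ (Fin n))) (L : ℝ) : Prop where
  volume_eq_one : volume K = 1
  constant_nonneg : 0 ≤ L
  integral_inner_sq : ∀ θ : EuclideanSpace ℝ (Fin n),
    ∫ x in K, (inner ℝ x θ) ^ 2 = L ^ 2 * ‖θ‖ ^ 2

/-- The least value of `(|K| / |B|)^(1/n)` over all Euclidean balls `B` (with any centre, of
positive radius) contained in `K`. The set is non-empty when `K` has an interior point, and it
is bounded below by `0`. -/
noncomputable def ballVolumeRatio {n : ℕ} (K : Set (EuclideanSpace ℝ (Fin n))) : ℝ :=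
  sInf {v : ℝ | ∃ (a : EuclideanSpace ℝ (Fin n)) (r : ℝ), 0 < r ∧ closedBall a r ⊆ K ∧
    v = (volume.real K / volume.real (closedBall a r)) ^ (1 / (n : ℝ))}

open scoped ENNReal Pointwise

/-! ### Prékopa–Leindler and Brunn–Minkowski for midpoints -/

section PrekopaLeindler

/-! Let `v` be a functional that is at most `1` on `K`, and let `B` be the cap where it is at least
`ε`. Points of `B` and `-B` are `2ε` apart in the norm of `K`, so by 2-convexity their midpoints lie
in `s • K` with `s = exp (-4αε²)`. Multiplicative Brunn–Minkowski gives `|B|² ≤ |sK|²`, hence `|B| ≤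
exp (-4αnε²)` (`IsTwoConvexBody.volume_cap_le`).

Integrating this tail bounds the second moment of `v` by `1/(2αn)`; isotropicity turns this into
`L²‖v‖² ≤ 1/(2αn)`, and Hahn–Banach separation turns the norm bound into an inscribed ball of radius
of order `√α √n L`. Since `L` is bounded below by a universal constant
(`IsIsotropicWith.one_le_mul_sq`), the factor `L` can be dropped. The ball of radius `√α √n / 4`
then contains a cube, which bounds the volume ratio. -/

theorem volume_add_volume_le_of_isCompact {A B S : Set ℝ} (hA : IsCompact A) (hB : IsCompact B)
    (hA₀ : A.Nonempty) (hB₀ : B.Nonempty) (hS : ∀ a ∈ A, ∀ b ∈ B, 2⁻¹ * (a + b) ∈ S) :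
    volume A + volume B ≤ 2 * volume S := by
  obtain ⟨p, hpA, hp⟩ := hA.exists_isGreatest hA₀
  obtain ⟨q, hqB, hq⟩ := hB.exists_isLeast hB₀
  have key : ∀ (T : Set ℝ) (c : ℝ), volume ((fun a => 2⁻¹ * (a + c)) ⁻¹' T) = 2 * volume T := by
    intro T c
    have h1 : (fun a : ℝ => 2⁻¹ * (a + c)) ⁻¹' T
        = (fun a => a + c) ⁻¹' ((fun a => 2⁻¹ * a) ⁻¹' T) := rfl
    rw [h1, measure_preimage_add_right, Real.volume_preimage_mul_left (by norm_num)]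
    norm_num
  -- With `p = max A` and `q = min B`, the halved translates `(A + q)/2` and `(p + B)/2` both lie in
  -- `S` and meet only at `(p + q)/2`.
  have h1 : volume A ≤ 2 * volume (S ∩ Set.Iic (2⁻¹ * (p + q))) := by
    rw [← key _ q]
    refine measure_mono fun a ha => ⟨hS a ha q hqB, ?_⟩
    have := hp ha
    simp only [Set.mem_Iic]
    linarith
  have h2 : volume B ≤ 2 * volume (S \ Set.Iic (2⁻¹ * (p + q))) := by
    rw [← key _ p, ← measure_sdiff_null (measure_singleton (μ := volume) q)]
    refine measure_mono fun b hb => ⟨?_, ?_⟩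
    · have := hS p hpA b hb.1
      rwa [add_comm] at this
    · have h3 := hq hb.1
      have h4 : b ≠ q := fun h => hb.2 h
      have h5 := lt_of_le_of_ne h3 h4.symm
      simp only [Set.mem_Iic, not_le]
      linarith
  calc volume A + volume B
      ≤ 2 * volume (S ∩ Set.Iic (2⁻¹ * (p + q))) + 2 * volume (S \ Set.Iic (2⁻¹ * (p + q))) :=
        add_le_add h1 h2
    _ = 2 * volume S := by rw [← mul_add, measure_inter_add_sdiff _ measurableSet_Iic]

/-- The one-dimensional Brunn–Minkowski inequality for the set of midpoints. -/
theorem volume_add_volume_le {A B S : Set ℝ} (hA : MeasurableSet A) (hB : MeasurableSet B)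
    (hA₀ : A.Nonempty) (hB₀ : B.Nonempty) (hS : ∀ a ∈ A, ∀ b ∈ B, 2⁻¹ * (a + b) ∈ S) :
    volume A + volume B ≤ 2 * volume S := by
  obtain ⟨a₀, ha₀⟩ := hA₀
  obtain ⟨b₀, hb₀⟩ := hB₀
  rw [hA.measure_eq_iSup_isCompact, hB.measure_eq_iSup_isCompact]
  simp only [iSup_and']
  refine ENNReal.biSup_add_biSup_le' ⟨∅, by simp⟩ ⟨∅, by simp⟩ ?_
  rintro A' ⟨hA'A, hA'⟩ B' ⟨hB'B, hB'⟩
  calc volume A' + volume B' ≤ volume (insert a₀ A') + volume (insert b₀ B') :=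
        add_le_add (measure_mono (Set.subset_insert _ _)) (measure_mono (Set.subset_insert _ _))
    _ ≤ 2 * volume S := volume_add_volume_le_of_isCompact (hA'.insert _) (hB'.insert _)
        (Set.insert_nonempty _ _) (Set.insert_nonempty _ _) fun a ha b hb =>
          hS a (Set.insert_subset ha₀ hA'A ha) b (Set.insert_subset hb₀ hB'B hb)

theorem volume_setOf_pos_and_ofReal_lt (a : ℝ≥0∞) :
    volume {t : ℝ | 0 < t ∧ ENNReal.ofReal t < a} = a := by
  by_cases ha : a = ∞
  · subst ha
    simp only [ENNReal.ofReal_lt_top, and_true]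
    exact Real.volume_Ioi
  · have : {t : ℝ | 0 < t ∧ ENNReal.ofReal t < a} = Set.Ioo 0 a.toReal := by
      ext t
      simp only [Set.mem_ofPred_eq, Set.mem_Ioo]
      exact and_congr_right fun ht => ENNReal.ofReal_lt_iff_lt_toReal ht.le ha
    rw [this, Real.volume_Ioo, sub_zero, ENNReal.ofReal_toReal ha]

/-- The layer cake formula for extended nonnegative functions. -/
theorem lintegral_eq_setLIntegral_Ioi_meas_lt {E : Type*} [MeasurableSpace E] (μ : Measure E)
    [SFinite μ] {f : E → ℝ≥0∞} (hf : Measurable f) :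
    ∫⁻ x, f x ∂μ = ∫⁻ t in Set.Ioi (0 : ℝ), μ {x | ENNReal.ofReal t < f x} := by
  have hm : MeasurableSet {p : E × ℝ | 0 < p.2 ∧ ENNReal.ofReal p.2 < f p.1} :=
    (measurableSet_lt measurable_const measurable_snd).inter
      (measurableSet_lt (ENNReal.measurable_ofReal.comp measurable_snd) (hf.comp measurable_fst))
  have h1 := Measure.prod_apply (μ := μ) (ν := (volume : Measure ℝ)) hm
  have h2 := Measure.prod_apply_symm (μ := μ) (ν := (volume : Measure ℝ)) hm
  rw [h1] at h2
  have h3 : ∀ x, volume (Prod.mk x ⁻¹' {p : E × ℝ | 0 < p.2 ∧ ENNReal.ofReal p.2 < f p.1})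
      = f x := fun x => volume_setOf_pos_and_ofReal_lt (f x)
  simp only [h3] at h2
  rw [h2, ← lintegral_indicator measurableSet_Ioi]
  refine lintegral_congr fun t => ?_
  by_cases ht : 0 < t
  · rw [Set.indicator_of_mem (show t ∈ Set.Ioi (0 : ℝ) from ht)]
    congr 1
    ext x
    simp [ht]
  · rw [Set.indicator_of_notMem (show t ∉ Set.Ioi (0 : ℝ) from ht)]
    convert measure_empty (μ := μ)
    ext x
    simp [ht]

theorem ENNReal.mul_le_sq_of_add_le_two_mul {a b c : ℝ≥0∞} (h : a + b ≤ 2 * c) :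
    a * b ≤ c ^ 2 := by
  by_cases hc : c = ∞
  · simp [hc]
  have hab : a + b ≠ ∞ := ne_top_of_le_ne_top (ENNReal.mul_ne_top (by simp) hc) h
  rw [ENNReal.add_ne_top] at hab
  lift a to NNReal using hab.1
  lift b to NNReal using hab.2
  lift c to NNReal using hc
  norm_cast at h ⊢
  rw [← NNReal.coe_le_coe] at h ⊢
  push_cast at h ⊢
  nlinarith [sq_nonneg ((a : ℝ) - b), a.coe_nonneg, b.coe_nonneg, c.coe_nonneg]

/-- Apply one-dimensional Brunn–Minkowski to superlevel sets and integrate over the level. Equal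
suprema make the sets of `f` and `g` nonempty for exactly the same levels. -/
theorem lintegral_add_lintegral_le_of_le_one {f g h : ℝ → ℝ≥0∞} (hf : Measurable f)
    (hg : Measurable g) (hh : Measurable h) (hf₁ : ⨆ x, f x = 1) (hg₁ : ⨆ x, g x = 1)
    (H : ∀ x y, f x * g y ≤ h (2⁻¹ * (x + y)) ^ 2) :
    (∫⁻ x, f x) + ∫⁻ x, g x ≤ 2 * ∫⁻ x, h x := by
  rw [lintegral_eq_setLIntegral_Ioi_meas_lt _ hf, lintegral_eq_setLIntegral_Ioi_meas_lt _ hg,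
    lintegral_eq_setLIntegral_Ioi_meas_lt _ hh, ← lintegral_const_mul' _ _ (by simp),
    ← lintegral_add_left]
  · refine lintegral_mono fun t => ?_
    dsimp only
    by_cases ht : ENNReal.ofReal t < 1
    · have hne : ∀ u : ℝ → ℝ≥0∞, ⨆ x, u x = 1 → {x | ENNReal.ofReal t < u x}.Nonempty :=
        fun u hu => lt_iSup_iff.1 (ht.trans_eq hu.symm)
      refine volume_add_volume_le (measurableSet_lt measurable_const hf)
        (measurableSet_lt measurable_const hg) (hne f hf₁) (hne g hg₁) fun x hx y hy => ?_
      have h1 : ENNReal.ofReal t ^ 2 < h (2⁻¹ * (x + y)) ^ 2 := by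
        refine lt_of_lt_of_le ?_ (H x y)
        rw [sq]
        exact ENNReal.mul_lt_mul hx hy
      exact (ENNReal.pow_right_strictMono two_ne_zero).lt_iff_lt.1 h1
    · have e : ∀ u : ℝ → ℝ≥0∞, ⨆ x, u x = 1 → {x | ENNReal.ofReal t < u x} = ∅ := by
        intro u hu
        ext x
        simp only [Set.mem_ofPred_eq, Set.mem_empty_iff_false, iff_false, not_lt]
        exact (le_iSup u x).trans (hu.le.trans (not_lt.1 ht))
      simp [e f hf₁, e g hg₁]
  · exact Antitone.measurable fun s t hst => measure_mono fun x hx =>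
      lt_of_le_of_lt (ENNReal.ofReal_le_ofReal hst) hx

/-- The midpoint Prékopa–Leindler inequality holds on `E`. -/
def MidpointPrekopaLeindler (E : Type*) [AddCommGroup E] [Module ℝ E] [MeasureSpace E] : Prop :=
  ∀ f g h : E → ℝ≥0∞, Measurable f → Measurable g → Measurable h →
    (∀ x y, f x * g y ≤ h ((2⁻¹ : ℝ) • (x + y)) ^ 2) →
      (∫⁻ x, f x) * ∫⁻ x, g x ≤ (∫⁻ x, h x) ^ 2

/-- Divide `f` and `g` by their suprema and `h` by the geometric mean of these; AM–GM then turns the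
sum into a product. -/
theorem lintegral_mul_lintegral_le_of_bounded {f g h : ℝ → ℝ≥0∞} (hf : Measurable f)
    (hg : Measurable g) (hh : Measurable h) (hf₁ : ⨆ x, f x ≠ ∞) (hg₁ : ⨆ x, g x ≠ ∞)
    (H : ∀ x y, f x * g y ≤ h (2⁻¹ * (x + y)) ^ 2) :
    (∫⁻ x, f x) * ∫⁻ x, g x ≤ (∫⁻ x, h x) ^ 2 := by
  set M := ⨆ x, f x with hM
  set N := ⨆ x, g x with hN
  by_cases hM0 : M = 0
  · have : ∀ x, f x = 0 := fun x => le_antisymm ((le_iSup f x).trans hM0.le) zero_le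
    simp [this]
  by_cases hN0 : N = 0
  · have : ∀ x, g x = 0 := fun x => le_antisymm ((le_iSup g x).trans hN0.le) zero_le
    simp [this]
  set s := (M * N) ^ (2⁻¹ : ℝ) with hs
  have hs2 : s ^ 2 = M * N := by
    rw [hs, ← ENNReal.rpow_natCast, ← ENNReal.rpow_mul]
    norm_num
  have hMN0 : M * N ≠ 0 := mul_ne_zero hM0 hN0
  have hMNt : M * N ≠ ∞ := ENNReal.mul_ne_top hf₁ hg₁
  have key := ENNReal.mul_le_sq_of_add_le_two_mul
    (lintegral_add_lintegral_le_of_le_one (f := fun x => M⁻¹ * f x) (g := fun x => N⁻¹ * g x)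
      (h := fun x => s⁻¹ * h x) (hf.const_mul _) (hg.const_mul _) (hh.const_mul _)
      (by rw [← ENNReal.mul_iSup]; exact ENNReal.inv_mul_cancel hM0 hf₁)
      (by rw [← ENNReal.mul_iSup]; exact ENNReal.inv_mul_cancel hN0 hg₁)
      (fun x y => by
        rw [mul_pow, ← ENNReal.inv_pow, hs2, mul_mul_mul_comm,
          ← ENNReal.mul_inv (Or.inl hM0) (Or.inl hf₁)]
        gcongr
        exact H x y))
  rw [lintegral_const_mul _ hf, lintegral_const_mul _ hg, lintegral_const_mul _ hh, mul_pow,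
    ← ENNReal.inv_pow, hs2, mul_mul_mul_comm, ← ENNReal.mul_inv (Or.inl hM0) (Or.inl hf₁)] at key
  exact (ENNReal.mul_le_mul_iff_right (ENNReal.inv_ne_zero.2 hMNt)
    (ENNReal.inv_ne_top.2 hMN0)).1 key

theorem iSup_lintegral_min_natCast {E : Type*} [MeasurableSpace E] {μ : Measure E}
    {f : E → ℝ≥0∞} (hf : Measurable f) : ⨆ k : ℕ, ∫⁻ x, min (f x) k ∂μ = ∫⁻ x, f x ∂μ := by
  rw [← lintegral_iSup (fun k => hf.min measurable_const)]
  · refine lintegral_congr fun x => ?_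
    rw [← inf_iSup_eq, ENNReal.iSup_natCast, inf_top_eq]
  · intro k l hkl x
    exact min_le_min_left _ (by exact_mod_cast hkl)

theorem midpointPrekopaLeindler_real : MidpointPrekopaLeindler ℝ := by
  intro f g h hf hg hh H
  rw [← iSup_lintegral_min_natCast hf, ← iSup_lintegral_min_natCast hg]
  simp only [ENNReal.iSup_mul, ENNReal.mul_iSup]
  refine iSup_le fun k => iSup_le fun l => ?_
  have hb : ∀ (u : ℝ → ℝ≥0∞) (k : ℕ), ⨆ x, min (u x) k ≠ ∞ := fun u k =>
    ne_top_of_le_ne_top (ENNReal.natCast_ne_top k) (iSup_le fun x => min_le_right _ _)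
  refine lintegral_mul_lintegral_le_of_bounded (hf.min measurable_const)
    (hg.min measurable_const) hh (hb f _) (hb g _) fun x y => ?_
  exact (mul_le_mul' (min_le_left _ _) (min_le_left _ _)).trans (H x y)

/-- By Tonelli, the inequality on the fibres `F` is the hypothesis on `E` for the marginals. -/
theorem MidpointPrekopaLeindler.prod {E F : Type*} [AddCommGroup E] [Module ℝ E] [MeasureSpace E]
    [AddCommGroup F] [Module ℝ F] [MeasureSpace F] [SFinite (volume : Measure F)]
    (hE : MidpointPrekopaLeindler E)
    (hF : MidpointPrekopaLeindler F) : MidpointPrekopaLeindler (E × F) := by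
  intro f g h hf hg hh H
  rw [Measure.volume_eq_prod, lintegral_prod _ hf.aemeasurable, lintegral_prod _ hg.aemeasurable,
    lintegral_prod _ hh.aemeasurable]
  refine hE _ _ _ hf.lintegral_prod_right' hg.lintegral_prod_right' hh.lintegral_prod_right'
    fun x y => ?_
  exact hF _ _ _ (hf.comp measurable_prodMk_left) (hg.comp measurable_prodMk_left)
    (hh.comp measurable_prodMk_left) fun x' y' => H (x, x') (y, y')

theorem MidpointPrekopaLeindler.of_measurePreserving {E F : Type*} [AddCommGroup E] [Module ℝ E]
    [MeasureSpace E] [AddCommGroup F] [Module ℝ F] [MeasureSpace F]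
    (hE : MidpointPrekopaLeindler E) (e : E →ₗ[ℝ] F) (he : MeasurePreserving e) :
    MidpointPrekopaLeindler F := by
  intro f g h hf hg hh H
  rw [← he.lintegral_comp hf, ← he.lintegral_comp hg, ← he.lintegral_comp hh]
  refine hE _ _ _ (hf.comp he.measurable) (hg.comp he.measurable) (hh.comp he.measurable)
    fun x y => ?_
  have := H (e x) (e y)
  rwa [← map_add, ← map_smul] at this

theorem midpointPrekopaLeindler_pi (n : ℕ) : MidpointPrekopaLeindler (Fin n → ℝ) := by
  induction n with
  | zero =>
    intro f g h hf hg hh H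
    simp only [lintegral_unique, Measure.volume_pi_eq_dirac (0 : Fin 0 → ℝ), measure_univ, mul_one]
    convert H default default
  | succ n ih =>
    refine (midpointPrekopaLeindler_real.prod ih).of_measurePreserving
      (Fin.consLinearEquiv ℝ (fun _ => ℝ)).toLinearMap ?_
    have h := (volume_preserving_piFinSuccAbove (fun _ : Fin (n + 1) => ℝ) 0).symm
    have e : ⇑(Fin.consLinearEquiv ℝ (fun _ : Fin (n + 1) => ℝ)).toLinearMap
        = ⇑(MeasurableEquiv.piFinSuccAbove (fun _ : Fin (n + 1) => ℝ) 0).symm := by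
      ext x i
      simp [MeasurableEquiv.piFinSuccAbove, Fin.insertNthEquiv]
    rw [e]
    exact h

theorem midpointPrekopaLeindler_euclideanSpace (n : ℕ) :
    MidpointPrekopaLeindler (EuclideanSpace ℝ (Fin n)) :=
  (midpointPrekopaLeindler_pi n).of_measurePreserving
    (WithLp.linearEquiv 2 ℝ (Fin n → ℝ)).symm.toLinearMap (PiLp.volume_preserving_toLp (Fin n))

/-- The multiplicative Brunn–Minkowski inequality for the set of midpoints. -/
theorem MidpointPrekopaLeindler.volume_mul_volume_le {E : Type*} [AddCommGroup E] [Module ℝ E]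
    [MeasureSpace E] (hE : MidpointPrekopaLeindler E) {A B S : Set E} (hA : MeasurableSet A)
    (hB : MeasurableSet B) (hS : MeasurableSet S)
    (h : ∀ a ∈ A, ∀ b ∈ B, (2⁻¹ : ℝ) • (a + b) ∈ S) :
    volume A * volume B ≤ volume S ^ 2 := by
  have := hE (A.indicator 1) (B.indicator 1) (S.indicator 1) (measurable_one.indicator hA)
    (measurable_one.indicator hB) (measurable_one.indicator hS) fun x y => by
      by_cases hx : x ∈ A
      · by_cases hy : y ∈ B
        · simp only [Set.indicator_of_mem hx, Set.indicator_of_mem hy,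
            Set.indicator_of_mem (h x hx y hy), Pi.one_apply, one_mul, one_pow, le_refl]
        · simp [hy]
      · simp [hx]
  simpa [lintegral_indicator_one hA, lintegral_indicator_one hB, lintegral_indicator_one hS]
    using this

end PrekopaLeindler

/-! ### Caps and second moments of 2-convex bodies -/

section TwoConvexBody

variable {n : ℕ} {K : Set (EuclideanSpace ℝ (Fin n))} {α L : ℝ}

theorem IsSymmConvexBody.neg_mem (hK : IsSymmConvexBody K) {x : EuclideanSpace ℝ (Fin n)}
    (hx : x ∈ K) : -x ∈ K := by
  rw [hK.symm] at hx
  exact hx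

theorem IsSymmConvexBody.mem_nhds_zero (hK : IsSymmConvexBody K) :
    K ∈ nhds (0 : EuclideanSpace ℝ (Fin n)) := by
  obtain ⟨x, hx⟩ := hK.nonempty_interior
  have hx' : -x ∈ K := hK.neg_mem (interior_subset hx)
  have := hK.convex.combo_interior_self_mem_interior hx hx' (a := 1 / 2) (b := 1 / 2)
    (by norm_num) (by norm_num) (by norm_num)
  rw [smul_neg, add_neg_cancel] at this
  exact mem_interior_iff_mem_nhds.1 this

theorem IsSymmConvexBody.mem_of_gauge_le_one (hK : IsSymmConvexBody K)
    {x : EuclideanSpace ℝ (Fin n)} (hx : gauge K x ≤ 1) : x ∈ K := by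
  rwa [gauge_le_one_iff_mem_closure hK.convex hK.mem_nhds_zero,
    hK.isCompact.isClosed.closure_eq] at hx

theorem IsSymmConvexBody.gauge_midpoint_le_one (hK : IsSymmConvexBody K)
    {x y : EuclideanSpace ℝ (Fin n)} (hx : gauge K x ≤ 1) (hy : gauge K y ≤ 1) :
    gauge K ((1 / 2 : ℝ) • (x + y)) ≤ 1 := by
  have h := gauge_add_le hK.convex (absorbent_nhds_zero hK.mem_nhds_zero) x y
  rw [gauge_smul_of_nonneg (by norm_num), smul_eq_mul]
  linarith

theorem IsTwoConvexBody.gauge_midpoint_le (hK : IsTwoConvexBody K α)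
    {x y : EuclideanSpace ℝ (Fin n)} {ε : ℝ} (hε : 0 < ε) (hε₂ : ε ≤ 2) (hx : gauge K x ≤ 1)
    (hy : gauge K y ≤ 1) (hxy : ε ≤ gauge K (x - y)) :
    gauge K ((1 / 2 : ℝ) • (x + y)) ≤ 1 - α * ε ^ 2 := by
  have h1 := hK.le_modulus ε hε hε₂
  have h2 : modulusOfConvexity K ε ≤ 1 - gauge K ((1 / 2 : ℝ) • (x + y)) := by
    refine csInf_le ⟨0, ?_⟩ ⟨x, y, hx, hy, hxy, rfl⟩
    rintro _ ⟨x, y, hx, hy, -, rfl⟩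
    exact sub_nonneg.2 (hK.symmConvexBody.gauge_midpoint_le_one hx hy)
  linarith

/-- If a linear functional is at most `1` on `K` then it is at most the gauge of `K`. -/
theorem inner_le_gauge (hK : IsSymmConvexBody K) {v : EuclideanSpace ℝ (Fin n)}
    (hv : ∀ x ∈ K, inner ℝ x v ≤ 1) (x : EuclideanSpace ℝ (Fin n)) :
    inner ℝ x v ≤ gauge K x := by
  refine le_of_forall_gt_imp_ge_of_dense fun a ha => ?_
  obtain ⟨b, hb, hba, y, hy, rfl⟩ := exists_lt_of_gauge_lt (absorbent_nhds_zero hK.mem_nhds_zero) ha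
  dsimp only
  rw [real_inner_smul_left]
  nlinarith [hv y hy]

/-- Gaussian decay of the volume of a cap of a `2`-convex body. -/
theorem IsTwoConvexBody.volume_cap_le (hK : IsTwoConvexBody K α) (hK₁ : volume K = 1)
    {v : EuclideanSpace ℝ (Fin n)} (hv : ∀ x ∈ K, inner ℝ x v ≤ 1) {ε : ℝ} (hε : 0 < ε) :
    volume (K ∩ {x | ε ≤ inner ℝ x v}) ≤ ENNReal.ofReal (Real.exp (-(4 * α * n * ε ^ 2))) := by
  have hB : MeasurableSet (K ∩ {x | ε ≤ inner ℝ x v}) :=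
    hK.symmConvexBody.isCompact.measurableSet.inter
      (measurableSet_le measurable_const (by fun_prop))
  set B := K ∩ {x | ε ≤ inner ℝ x v} with hBdef
  set s := Real.exp (-(4 * α * ε ^ 2)) with hs
  have hs0 : 0 < s := Real.exp_pos _
  have hmid : ∀ a ∈ -B, ∀ b ∈ B, (2⁻¹ : ℝ) • (a + b) ∈ s • K := by
    rintro a ha b ⟨hbK, hb⟩
    obtain ⟨haK, ha'⟩ : -a ∈ B := ha
    simp only [Set.mem_ofPred_eq, inner_neg_left] at hb ha'
    have haK' : a ∈ K := by simpa using hK.symmConvexBody.neg_mem haK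
    -- A point in the cap forces `ε ≤ 1`, so `2 * ε` is within the range of the modulus; for larger
    -- `ε` the cap is empty.
    have hε1 : ε ≤ 1 := hb.trans (hv b hbK)
    have hd : 2 * ε ≤ gauge K (b - a) := by
      refine le_trans ?_ (inner_le_gauge hK.symmConvexBody hv _)
      rw [inner_sub_left]
      linarith
    have h1 := hK.gauge_midpoint_le (by linarith) (by linarith) (gauge_le_one_of_mem hbK)
      (gauge_le_one_of_mem haK') hd
    have h2 := Real.add_one_le_exp (-(4 * α * ε ^ 2))
    rw [Set.mem_smul_set_iff_inv_smul_mem₀ hs0.ne']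
    apply hK.symmConvexBody.mem_of_gauge_le_one
    rw [gauge_smul_of_nonneg (inv_nonneg.2 hs0.le), smul_eq_mul, inv_mul_le_iff₀ hs0, mul_one,
      add_comm a b, ← one_div]
    refine h1.trans (le_trans (le_of_eq ?_) h2)
    ring
  have key := (midpointPrekopaLeindler_euclideanSpace n).volume_mul_volume_le hB.neg hB
    (hK.symmConvexBody.isCompact.smul s).measurableSet hmid
  rw [Measure.measure_neg, ← sq, ENNReal.pow_le_pow_left_iff two_ne_zero,
    Measure.addHaar_smul_of_nonneg _ hs0.le, hK₁, mul_one, finrank_euclideanSpace_fin] at key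
  convert key using 3
  rw [hs, ← Real.exp_nat_mul]
  congr 1
  ring

/-- Layer cake in the level `t` of the squared functional: the superlevel set is covered by the two
opposite caps at height `√t`. -/
theorem IsTwoConvexBody.setIntegral_inner_sq_le (hK : IsTwoConvexBody K α) (hK₁ : volume K = 1)
    (hα : 0 < α) (hn : 1 ≤ n) {v : EuclideanSpace ℝ (Fin n)} (hv : ∀ x ∈ K, inner ℝ x v ≤ 1) :
    ∫ x in K, (inner ℝ x v) ^ 2 ≤ 1 / (2 * α * n) := by
  have hn' : (0 : ℝ) < n := by exact_mod_cast hn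
  have hc : 0 < 4 * α * n := by positivity
  have hKm := hK.symmConvexBody.isCompact.measurableSet
  have hint : IntegrableOn (fun x => (inner ℝ x v) ^ 2) K :=
    ContinuousOn.integrableOn_compact hK.symmConvexBody.isCompact (by fun_prop)
  rw [hint.integral_eq_integral_meas_le (Filter.Eventually.of_forall fun x => sq_nonneg _)]
  have hexp : ∫ t in Set.Ioi (0 : ℝ), 2 * Real.exp (-(4 * α * n) * t) = 1 / (2 * α * n) := by
    rw [integral_const_mul, integral_exp_mul_Ioi (by linarith)]
    simp only [mul_zero, Real.exp_zero]
    field_simp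
    norm_num
  rw [← hexp]
  refine integral_mono_of_nonneg (Filter.Eventually.of_forall fun t => measureReal_nonneg)
    ((integrableOn_exp_mul_Ioi (by linarith) 0).const_mul 2) ?_
  filter_upwards [ae_restrict_mem measurableSet_Ioi] with t ht
  have ht : 0 < t := ht
  have hv' : ∀ x ∈ K, inner ℝ x (-v) ≤ 1 := fun x hx => by
    have := hv (-x) (hK.symmConvexBody.neg_mem hx)
    rwa [inner_neg_left, ← inner_neg_right] at this
  have h1 := hK.volume_cap_le hK₁ hv (Real.sqrt_pos.2 ht)
  have h2 := hK.volume_cap_le hK₁ hv' (Real.sqrt_pos.2 ht)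
  rw [Real.sq_sqrt ht.le, ← neg_mul] at h1 h2
  refine ENNReal.toReal_le_of_le_ofReal (by positivity) ?_
  rw [two_mul, ENNReal.ofReal_add (by positivity) (by positivity)]
  refine le_trans ?_ (add_le_add h1 h2)
  rw [Measure.restrict_apply' hKm]
  refine le_trans (measure_mono ?_) (measure_union_le _ _)
  rintro x ⟨hx, hxK⟩
  have hx' : √t ≤ |inner ℝ x v| := Real.sqrt_le_sqrt hx |>.trans (Real.sqrt_sq_eq_abs _).le
  rcases le_abs.1 hx' with h | h
  · exact Or.inl ⟨hxK, h⟩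
  · exact Or.inr ⟨hxK, by simpa [inner_neg_right] using h⟩

/-! ### Lower bound for the isotropic constant -/

theorem IsIsotropicWith.setIntegral_norm_sq (hK : IsIsotropicWith K L) (hKc : IsCompact K) :
    ∫ x in K, ‖x‖ ^ 2 = n * L ^ 2 := by
  have h : ∀ x : EuclideanSpace ℝ (Fin n),
      ‖x‖ ^ 2 = ∑ i, (inner ℝ x (EuclideanSpace.basisFun (Fin n) ℝ i)) ^ 2 := fun x => by
    rw [← (EuclideanSpace.basisFun (Fin n) ℝ).sum_sq_norm_inner_left x]
    simp
  simp_rw [h]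
  rw [integral_finsetSum _ fun i _ =>
    ContinuousOn.integrableOn_compact hKc (by fun_prop)]
  simp_rw [hK.integral_inner_sq]
  simp

/-- The isotropic constant is bounded below by a universal constant. -/
theorem IsIsotropicWith.one_le_mul_sq (hK : IsIsotropicWith K L) (hKc : IsCompact K)
    (hn : 1 ≤ n) : 1 ≤ 2 * Real.pi * Real.exp 1 * L ^ 2 := by
  have hn' : (0 : ℝ) < n := by exact_mod_cast hn
  -- This choice makes the Gaussian integral `(π/t)^(n/2)` equal to `exp (-n/2)`.
  set t := Real.pi * Real.exp 1 with ht
  have ht0 : 0 < t := by positivity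
  set b := t * (n * L ^ 2) with hb
  have hvol : (volume.restrict K).real Set.univ = 1 := by
    simp [measureReal_def, hK.volume_eq_one]
  have hsq : IntegrableOn (fun x : EuclideanSpace ℝ (Fin n) => ‖x‖ ^ 2) K :=
    ContinuousOn.integrableOn_compact hKc (by fun_prop)
  have : IsFiniteMeasure (volume.restrict K) := ⟨by simp [hK.volume_eq_one]⟩
  have hgauss := GaussianFourier.integral_rexp_neg_mul_sq_norm (V := EuclideanSpace ℝ (Fin n)) ht0
  have hpos : 0 < (Real.pi / t) ^ (Module.finrank ℝ (EuclideanSpace ℝ (Fin n)) / 2 : ℝ) := by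
    positivity
  have hgint : Integrable fun x : EuclideanSpace ℝ (Fin n) => Real.exp (-t * ‖x‖ ^ 2) :=
    not_imp_comm.1 integral_undef (by rw [hgauss]; exact hpos.ne')
  have h1 : Real.exp (-b) ≤ ∫ x : EuclideanSpace ℝ (Fin n), Real.exp (-t * ‖x‖ ^ 2) := by
    -- Jensen by hand: `b` is the mean of `t‖x‖²` over `K`, and the integrand is the tangent line of
    -- the exponential at `-b`.
    calc Real.exp (-b)
        = ∫ x in K, Real.exp (-b) * ((1 + b) - t * ‖x‖ ^ 2) := by
          rw [integral_const_mul, integral_sub (integrable_const _) (hsq.const_mul t),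
            integral_const_mul, hK.setIntegral_norm_sq hKc, integral_const, hvol, ← hb]
          simp
      _ ≤ ∫ x in K, Real.exp (-t * ‖x‖ ^ 2) := by
          refine integral_mono (((integrable_const _).sub (hsq.const_mul t)).const_mul _)
            hgint.integrableOn fun x => ?_
          have h2 := Real.add_one_le_exp (b - t * ‖x‖ ^ 2)
          calc Real.exp (-b) * ((1 + b) - t * ‖x‖ ^ 2)
              ≤ Real.exp (-b) * Real.exp (b - t * ‖x‖ ^ 2) := by
                gcongr
                linarith
            _ = Real.exp (-t * ‖x‖ ^ 2) := by
                rw [← Real.exp_add]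
                congr 1
                ring
      _ ≤ _ := setIntegral_le_integral hgint (Filter.Eventually.of_forall fun x =>
          (Real.exp_pos _).le)
  have h3 : Real.pi / t = Real.exp (-1) := by
    rw [ht, Real.exp_neg]
    field_simp
  rw [hgauss, h3, ← Real.exp_mul, Real.exp_le_exp, finrank_euclideanSpace_fin, hb] at h1
  have h4 : (n : ℝ) * 1 ≤ n * (2 * t * L ^ 2) := by linarith
  have h5 := le_of_mul_le_mul_left h4 hn'
  rw [ht] at h5
  linarith

/-- A closed convex set contains the ball of radius `r` about the origin as soon as every
functional that is at most `1` on the set has norm at most `r⁻¹`. -/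
theorem closedBall_subset_of_forall_inner_le_one (hK : IsSymmConvexBody K) {r : ℝ}
    (h : ∀ v, (∀ x ∈ K, inner ℝ x v ≤ 1) → r * ‖v‖ ≤ 1) :
    closedBall (0 : EuclideanSpace ℝ (Fin n)) r ⊆ K := by
  intro y hy
  by_contra hyK
  obtain ⟨f, u, hf, hu⟩ := geometric_hahn_banach_closed_point hK.convex hK.isCompact.isClosed hyK
  have hu0 : 0 < u := by simpa using hf 0 (mem_of_mem_nhds hK.mem_nhds_zero)
  obtain ⟨w, rfl⟩ := (InnerProductSpace.toDual ℝ (EuclideanSpace ℝ (Fin n))).surjective f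
  simp only [InnerProductSpace.toDual_apply_apply] at hf hu
  have h1 := h (u⁻¹ • w) fun x hx => by
    rw [real_inner_smul_right, inv_mul_le_iff₀ hu0, mul_one, real_inner_comm]
    exact (hf x hx).le
  have h2 : u < r * ‖w‖ := by
    refine hu.trans_le ((real_inner_le_norm w y).trans ?_)
    rw [mul_comm]
    gcongr
    simpa using hy
  rw [norm_smul, norm_inv, Real.norm_of_nonneg hu0.le, mul_left_comm, inv_mul_le_iff₀ hu0] at h1
  linarith

/-- A Euclidean ball contains the inscribed cube. -/
theorem pow_le_volume_real_closedBall (hn : 1 ≤ n) {s : ℝ} (hs : 0 ≤ s) :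
    (2 * s) ^ n ≤ volume.real (closedBall (0 : EuclideanSpace ℝ (Fin n)) (s * √n)) := by
  have hsub : (WithLp.toLp 2) ⁻¹' closedBall (0 : EuclideanSpace ℝ (Fin n)) (s * √n) ⊇
      Set.Icc (fun _ : Fin n => -s) (fun _ => s) := by
    intro x hx
    simp only [Set.mem_preimage, mem_closedBall, dist_zero_right, EuclideanSpace.norm_eq]
    rw [show s * √(n : ℝ) = √(n * s ^ 2) by
      rw [Real.sqrt_mul (by positivity), Real.sqrt_sq hs, mul_comm]]
    refine Real.sqrt_le_sqrt ?_
    calc ∑ i, ‖x i‖ ^ 2 ≤ ∑ _i : Fin n, s ^ 2 := by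
          gcongr with i
          exact abs_le.2 ⟨hx.1 i, hx.2 i⟩
      _ = n * s ^ 2 := by simp
  have h := measure_mono (μ := volume) hsub
  rw [(PiLp.volume_preserving_toLp (Fin n)).measure_preimage
    measurableSet_closedBall.nullMeasurableSet, Real.volume_Icc_pi] at h
  have h2 := ENNReal.toReal_mono measure_closedBall_lt_top.ne h
  refine le_trans (le_of_eq ?_) h2
  have : s - -s = 2 * s := by ring
  simp [this, hs]

end TwoConvexBody

/-! ### Assembly and constants -/

theorem proposition3 :
    ∃ c C : ℝ, 0 < c ∧ 0 < C ∧
      ∀ (n : ℕ) (K : Set (EuclideanSpace ℝ (Fin n))) (α L : ℝ),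
        1 ≤ n → 0 < α → IsTwoConvexBody K α → IsIsotropicWith K L →
          closedBall (0 : EuclideanSpace ℝ (Fin n)) (c * √α * √(n : ℝ)) ⊆ K ∧
          closedBall (0 : EuclideanSpace ℝ (Fin n)) (c * √α * √(n : ℝ) * L) ⊆ K ∧
          ballVolumeRatio K ≤ C / √α := by
  refine ⟨1 / 4, 2, by norm_num, by norm_num, fun n K α L hn hα hK hL => ?_⟩
  have hn' : (0 : ℝ) < n := by exact_mod_cast hn
  have hsα : 0 < √α := Real.sqrt_pos.2 hα
  have hsn : 0 < √(n : ℝ) := Real.sqrt_pos.2 hn'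
  have hbody := hK.symmConvexBody
  have hmom : ∀ v, (∀ x ∈ K, inner ℝ x v ≤ 1) → 2 * (√α * √n * L * ‖v‖) ^ 2 ≤ 1 := by
    intro v hv
    have h := hK.setIntegral_inner_sq_le hL.volume_eq_one hα hn hv
    rw [hL.integral_inner_sq, le_div_iff₀ (by positivity)] at h
    rw [mul_pow, mul_pow, mul_pow, Real.sq_sqrt hα.le, Real.sq_sqrt hn'.le]
    linarith
  -- `2πe ≈ 17.08`. With `2L²w² ≤ 1` this gives `w² ≤ 9`, which leaves room for the constant `1/4`.
  have hLow : 1 ≤ 18 * L ^ 2 := by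
    refine (hL.one_le_mul_sq hbody.isCompact hn).trans ?_
    gcongr
    have h1 := Real.pi_lt_d2
    have h2 := Real.exp_one_lt_d9
    have h3 := Real.pi_pos
    nlinarith
  have hball : closedBall (0 : EuclideanSpace ℝ (Fin n)) (1 / 4 * √α * √(n : ℝ)) ⊆ K := by
    refine closedBall_subset_of_forall_inner_le_one hbody fun v hv => ?_
    have h1 := hmom v hv
    set w := √α * √n * ‖v‖ with hw
    have h2 : 2 * (L ^ 2 * w ^ 2) ≤ 1 := by
      refine le_trans (le_of_eq ?_) h1
      rw [hw]
      ring
    have h3 : w ^ 2 ≤ 4 ^ 2 := by nlinarith [sq_nonneg w]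
    have h4 : w ≤ 4 := le_of_abs_le (abs_le_of_sq_le_sq h3 (by norm_num))
    linarith
  refine ⟨hball, ?_, ?_⟩
  · refine closedBall_subset_of_forall_inner_le_one hbody fun v hv => ?_
    have h1 := hmom v hv
    have h2 : √α * √n * L * ‖v‖ ≤ 1 := by nlinarith
    nlinarith
  · have hr : 0 < 1 / 4 * √α * √(n : ℝ) := by positivity
    have hle : ballVolumeRatio K ≤ (volume.real K / volume.real
        (closedBall (0 : EuclideanSpace ℝ (Fin n)) (1 / 4 * √α * √(n : ℝ)))) ^ (1 / (n : ℝ)) := by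
      refine csInf_le ⟨0, ?_⟩ ⟨0, _, hr, hball, rfl⟩
      rintro _ ⟨a, r, -, -, rfl⟩
      positivity
    refine hle.trans ?_
    -- The inscribed cube has side `√α / 2`, whence the constant `2 / √α`.
    have h1 := pow_le_volume_real_closedBall hn (s := 1 / 4 * √α) (by positivity)
    have hvol : volume.real K = 1 := by simp [measureReal_def, hL.volume_eq_one]
    calc (volume.real K / volume.real
          (closedBall (0 : EuclideanSpace ℝ (Fin n)) (1 / 4 * √α * √(n : ℝ)))) ^ (1 / (n : ℝ))
        ≤ (1 / (2 * (1 / 4 * √α)) ^ n) ^ (1 / (n : ℝ)) := by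
          rw [hvol]
          gcongr
      _ = ((2 / √α) ^ n) ^ (1 / (n : ℝ)) := by
          rw [← one_div_pow]
          congr 2
          field_simp
          norm_num
      _ = 2 / √α := by
          rw [one_div, Real.pow_rpow_inv_natCast (by positivity) (by omega)]
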